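/- Let $(\bar M,g)$ be a smooth Riemannian manifold of dimension $n+r$ with Levi-Civita connection $\bar\nabla$, and let $J$ be a smooth $(1,1)$-tensor field on $\bar M$ such that, for some positive integers $p,q$, $$J^2=pJ+q\,\mathrm{Id},\qquad g(JX,Y)=g(X,JY)\ \text{ for all vector fields } X,Y,\qquad \bar\nabla J=0$$ (that is, $(\bar M,J,g)$ is a locally metallic Riemannian manifold). Let $M$ be a smooth $n$-dimensional submanifold of codimension $r$ isometrically immersed in $\bar M$, with Levi-Civita connection $\nabla$ of the induced metric, and assume that $M$ is invariant, i.e. $J(T_xM)\subset T_xM$ for every $x\in M$. Denote the restriction of $J$ to $TM$ again by $J$. For an orthonormal basis $N_1,\dots,N_r$ of the normal space $T_xM^{\perp}$ let $h_\alpha(X,Y)=g(h(X,Y),N_\alpha)$, where the second fundamental form $h(X,Y)=(\bar\nabla_XY)^{\perp}$ is the normal component of $\bar\nabla_XY$, so that $h(X,Y)=\sum_{\alpha=1}^r h_\alpha(X,Y)N_\alpha$. Then, for all vector fields $X,Y$ on $M$ and at every point of $M$: 1. $\nabla J=0$ on $M$, i.e. $(\nabla_XJ)Y:=\nabla_X(JY)-J(\nabla_XY)=0$;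 2. $\displaystyle\sum_{\alpha=1}^r h_\alpha(X,JY)N_\alpha=\sum_{\alpha=1}^r h_\alpha(X,Y)\,JN_\alpha=\sum_{\alpha=1}^r h_\alpha(JX,Y)N_\alpha$; 3. $h_\alpha(JX,JY)=p\,h_\alpha(X,JY)+q\,h_\alpha(X,Y)$ for every $1\le\alpha\le r$. -/

import Mathlib

open Bundle Manifold FiberBundle VectorField
open scoped ContDiff

noncomputable section

set_option linter.unusedSectionVars false

namespace Riem

section LeviCivita
variable {E : Type*} [NormedAddCommGroup E] [NormedSpace ℝ E] [FiniteDimensional ℝ E]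
  {H : Type*} [TopologicalSpace H] (I : ModelWithCorners ℝ E H)
  {M : Type*} [TopologicalSpace M] [ChartedSpace H M] [IsManifold I ∞ M]
  [RiemannianBundle (fun x : M ↦ TangentSpace I x)]
  [IsContMDiffRiemannianBundle I ∞ E (fun x : M ↦ TangentSpace I x)]

instance finiteDimensional_tangentSpace (x : M) :
    FiniteDimensional ℝ (TangentSpace I x) := inferInstanceAs (FiniteDimensional ℝ E)
instance completeSpace_tangentSpace (x : M) : CompleteSpace (TangentSpace I x) :=
  FiniteDimensional.complete ℝ _

/-- Half of the right-hand side of the Koszul formula for `2 g(∇_X Y, Z)` at `x`. -/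
def koszul (X Y Z : Π x : M, TangentSpace I x) (x : M) : ℝ :=
  (1 / 2 : ℝ) * (mvfderiv I (fun y ↦ inner ℝ (Y y) (Z y)) x (X x)
    + mvfderiv I (fun y ↦ inner ℝ (X y) (Z y)) x (Y x)
    - mvfderiv I (fun y ↦ inner ℝ (X y) (Y y)) x (Z x)
    + inner ℝ (mlieBracket I X Y x) (Z x)
    - inner ℝ (mlieBracket I X Z x) (Y x)
    - inner ℝ (mlieBracket I Y Z x) (X x))

variable {I} {x : M}

lemma mdifferentiableAt_inner {X Y : Π x : M, TangentSpace I x}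
    (hX : MDiffAt (T% X) x) (hY : MDiffAt (T% Y) x) :
    MDifferentiableAt I 𝓘(ℝ, ℝ) (fun y ↦ (inner ℝ (X y) (Y y) : ℝ)) x := by
  have := MDifferentiableAt.inner_bundle (F := E) (E := fun x : M ↦ TangentSpace I x) (b := id)
    hX hY
  exact this

lemma koszul_tensorial₁ {Y Z : Π x : M, TangentSpace I x}
    (hY : MDiffAt (T% Y) x) (hZ : MDiffAt (T% Z) x) :
    TensorialAt I E (koszul I · Y Z x) x where
  smul {f X} hf hX := by
    have h1 := mdifferentiableAt_inner hX hZ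
    have h2 := mdifferentiableAt_inner hX hY
    simp [koszul, mlieBracket_smul_left hf hX,
      mvfderiv_fun_mul hf h1, mvfderiv_fun_mul hf h2, inner_add_left, inner_smul_left, inner_smul_right]
    ring
  add {X X'} hX hX' := by
    have h1 := mdifferentiableAt_inner hX hZ
    have h2 := mdifferentiableAt_inner hX hY
    have h1' := mdifferentiableAt_inner hX' hZ
    have h2' := mdifferentiableAt_inner hX' hY
    simp [koszul, mlieBracket_add_left hX hX',
      mvfderiv_fun_add h1 h1', mvfderiv_fun_add h2 h2', inner_add_left, inner_add_right]
    ring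

lemma koszul_tensorial₃ {X Y : Π x : M, TangentSpace I x}
    (hX : MDiffAt (T% X) x) (hY : MDiffAt (T% Y) x) :
    TensorialAt I E (koszul I X Y · x) x where
  smul {f Z} hf hZ := by
    have h1 := mdifferentiableAt_inner hX hZ
    have h2 := mdifferentiableAt_inner hY hZ
    simp [koszul, mlieBracket_smul_right hf hZ,
      mvfderiv_fun_mul hf h1, mvfderiv_fun_mul hf h2, inner_add_left, inner_smul_left, inner_smul_right]
    rw [real_inner_comm (X x) (Z x), real_inner_comm (Y x) (Z x)]
    ring
  add {Z Z'} hZ hZ' := by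
    have h1 := mdifferentiableAt_inner hX hZ
    have h2 := mdifferentiableAt_inner hY hZ
    have h1' := mdifferentiableAt_inner hX hZ'
    have h2' := mdifferentiableAt_inner hY hZ'
    simp [koszul, mlieBracket_add_right hZ hZ',
      mvfderiv_fun_add h1 h1', mvfderiv_fun_add h2 h2', inner_add_left, inner_add_right]
    ring

lemma exists_koszul {Y : Π x : M, TangentSpace I x} (hY : MDiffAt (T% Y) x) :
    ∃ L : TangentSpace I x →L[ℝ] TangentSpace I x, ∀ X Z : Π x : M, TangentSpace I x,
      MDiffAt (T% X) x → MDiffAt (T% Z) x → inner ℝ (L (X x)) (Z x) = koszul I X Y Z x := by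
  let B : TangentSpace I x →L[ℝ] TangentSpace I x →L[ℝ] ℝ :=
    TensorialAt.mkHom₂ (I := I) (F := E) (F' := E) (fun X Z ↦ koszul I X Y Z x) x
      (fun Z hZ ↦ koszul_tensorial₁ hY hZ) (fun X hX ↦ koszul_tensorial₃ hX hY)
  refine ⟨InnerProductSpace.continuousLinearMapOfBilin (𝕜 := ℝ) B, fun X Z hX hZ ↦ ?_⟩
  rw [InnerProductSpace.continuousLinearMapOfBilin_apply]
  exact TensorialAt.mkHom₂_apply (I := I) (F := E) (F' := E) (Φ := fun X Z ↦ koszul I X Y Z x)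
      (fun Z hZ ↦ koszul_tensorial₁ hY hZ) (fun X hX ↦ koszul_tensorial₃ hX hY) hX hZ


variable (I) in
/-- The value at `x` of the Levi-Civita covariant derivative of `Y` (the junk value `0` if `Y` is
not differentiable at `x`). -/
def leviCivitaFun (Y : Π x : M, TangentSpace I x) (x : M) :
    TangentSpace I x →L[ℝ] TangentSpace I x :=
  open Classical in if hY : MDiffAt (T% Y) x then (exists_koszul hY).choose else 0

lemma inner_leviCivitaFun {X Y Z : Π x : M, TangentSpace I x} (hX : MDiffAt (T% X) x)
    (hY : MDiffAt (T% Y) x) (hZ : MDiffAt (T% Z) x) :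
    inner ℝ (leviCivitaFun I Y x (X x)) (Z x) = koszul I X Y Z x := by
  rw [leviCivitaFun, dif_pos hY]
  exact (exists_koszul hY).choose_spec X Z hX hZ

lemma ext_of_inner {A B : TangentSpace I x →L[ℝ] TangentSpace I x}
    (h : ∀ X Z : Π x : M, TangentSpace I x, MDiffAt (T% X) x → MDiffAt (T% Z) x →
      inner ℝ (A (X x)) (Z x) = inner ℝ (B (X x)) (Z x)) : A = B := by
  ext v
  refine ext_inner_right ℝ fun w ↦ ?_
  have := h (extend E v) (extend E w) (mdifferentiableAt_extend ..) (mdifferentiableAt_extend ..)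
  simpa using this

variable (I M) in
/-- The Levi-Civita connection of a Riemannian manifold, obtained from the Koszul formula; it is
torsion-free and metric, by `leviCivita_torsion` and `leviCivita_metric`. As in
`CovariantDerivative`,
`leviCivita I M Y x (X x)` is `(∇_X Y) x`. -/
def leviCivita : CovariantDerivative I E (fun x : M ↦ TangentSpace I x) where
  toFun := leviCivitaFun I
  isCovariantDerivativeOnUniv :=
    { add := by
        intro Y Y' x hY hY' _
        refine ext_of_inner fun X Z hX hZ ↦ ?_
        have hs := mdifferentiableAt_add_section hY hY'
        rw [inner_leviCivitaFun hX hs hZ, add_apply, inner_add_left,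
          inner_leviCivitaFun hX hY hZ, inner_leviCivitaFun hX hY' hZ]
        have h1 := mdifferentiableAt_inner hY hZ
        have h2 := mdifferentiableAt_inner hX hY
        have h1' := mdifferentiableAt_inner hY' hZ
        have h2' := mdifferentiableAt_inner hX hY'
        simp [koszul, mlieBracket_add_left hY hY', mlieBracket_add_right hY hY',
          mvfderiv_fun_add h1 h1', mvfderiv_fun_add h2 h2', inner_add_left, inner_add_right]
        ring
      leibniz := by
        intro Y f x hY hf _
        refine ext_of_inner fun X Z hX hZ ↦ ?_
        have hs := hf.smul_section hY
        rw [inner_leviCivitaFun hX hs hZ, add_apply, inner_add_left,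
          smul_apply, inner_smul_left, inner_leviCivitaFun hX hY hZ]
        have h1 := mdifferentiableAt_inner hY hZ
        have h2 := mdifferentiableAt_inner hX hY
        simp [koszul, mlieBracket_smul_left hf hY, mlieBracket_smul_right hf hY,
          mvfderiv_fun_mul hf h1, mvfderiv_fun_mul hf h2, inner_add_left, inner_smul_left,
          inner_smul_right]
        rw [real_inner_comm (X x) (Y x)]
        ring }

/-- The Levi-Civita connection is torsion-free. -/
theorem leviCivita_torsion : (leviCivita I M).torsion = 0 := by
  rw [CovariantDerivative.torsion_eq_zero_iff]
  intro X Y x hX hY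
  refine ext_inner_right ℝ fun w ↦ ?_
  have hw : MDiffAt (T% (extend E w : Π x : M, TangentSpace I x)) x := mdifferentiableAt_extend ..
  have h1 := inner_leviCivitaFun hX hY hw
  have h2 := inner_leviCivitaFun hY hX hw
  rw [extend_apply_self] at h1 h2
  rw [inner_sub_left]
  refine (congrArg₂ (· - ·) h1 h2).trans ?_
  have h : (fun y ↦ inner ℝ (Y y) (X y)) = fun y ↦ (inner ℝ (X y) (Y y) : ℝ) :=
    funext fun y ↦ real_inner_comm _ _
  simp only [koszul, mlieBracket_swap_apply (V := Y) (W := X), extend_apply_self, inner_neg_left, h]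
  ring

/-- The Levi-Civita connection is compatible with the metric. -/
theorem leviCivita_metric {X Y Z : Π x : M, TangentSpace I x} (hX : MDiffAt (T% X) x)
    (hY : MDiffAt (T% Y) x) (hZ : MDiffAt (T% Z) x) :
    mvfderiv I (fun y ↦ inner ℝ (Y y) (Z y)) x (X x)
      = inner ℝ (leviCivita I M Y x (X x)) (Z x) + inner ℝ (Y x) (leviCivita I M Z x (X x)) := by
  rw [real_inner_comm _ (Y x)]
  refine Eq.trans ?_ (congrArg₂ (· + ·) (inner_leviCivitaFun hX hY hZ)
    (inner_leviCivitaFun hX hZ hY)).symm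
  have h : (fun y ↦ inner ℝ (Z y) (Y y)) = fun y ↦ (inner ℝ (Y y) (Z y) : ℝ) :=
    funext fun y ↦ real_inner_comm _ _
  simp only [koszul, mlieBracket_swap_apply (V := Z) (W := Y), inner_neg_left, h]
  ring

end LeviCivita

section Metallic

variable {E : Type*} [NormedAddCommGroup E] [NormedSpace ℝ E] [FiniteDimensional ℝ E]
  {H : Type*} [TopologicalSpace H] {I : ModelWithCorners ℝ E H}
  {M : Type*} [TopologicalSpace M] [ChartedSpace H M] [IsManifold I ∞ M]

/-- The endomorphism field `J` is covariant constant, `∇J = 0`: for each vector field `Y`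
differentiable at `x`, so is `JY`, and `(∇_v J) Y = ∇_v (JY) - J (∇_v Y) = 0` for `v ∈ T_x M`. -/
def IsCovariantConstant (D : CovariantDerivative I E (fun x : M ↦ TangentSpace I x))
    (J : Π x : M, TangentSpace I x →L[ℝ] TangentSpace I x) : Prop :=
  ∀ (x : M) (Y : Π x : M, TangentSpace I x), MDiffAt (T% Y) x →
    MDiffAt (T% (fun y ↦ J y (Y y))) x ∧
      ∀ v : TangentSpace I x, D (fun y ↦ J y (Y y)) x v = J x (D Y x v)

variable [RiemannianBundle (fun x : M ↦ TangentSpace I x)]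

/-- `J` is a metallic structure, `J² = pJ + qI` with `p`, `q` positive integers, compatible with the
Riemannian metric, `g(JX, Y) = g(X, JY)`. -/
structure IsMetallicRiemannian (p q : ℕ)
    (J : Π x : M, TangentSpace I x →L[ℝ] TangentSpace I x) : Prop where
  p_pos : 0 < p
  q_pos : 0 < q
  contMDiff : ContMDiff I (I.prod 𝓘(ℝ, E →L[ℝ] E)) ∞
    (fun x ↦ TotalSpace.mk' (E →L[ℝ] E) (E := fun x : M ↦ TangentSpace I x →L[ℝ] TangentSpace I x)
      x (J x))
  sq_apply : ∀ (x : M) (v : TangentSpace I x), J x (J x v) = (p : ℝ) • J x v + (q : ℝ) • v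
  inner_comm : ∀ (x : M) (v w : TangentSpace I x), inner ℝ (J x v) w = inner ℝ v (J x w)

/-- A locally metallic Riemannian manifold: `J` is moreover covariant constant for the Levi-Civita
connection. -/
structure IsLocallyMetallic [IsContMDiffRiemannianBundle I ∞ E (fun x : M ↦ TangentSpace I x)]
    (p q : ℕ) (J : Π x : M, TangentSpace I x →L[ℝ] TangentSpace I x) : Prop
    extends IsMetallicRiemannian p q J where
  covariantConstant : IsCovariantConstant (leviCivita I M) J

end Metallic

section Along

variable {E : Type*} [NormedAddCommGroup E] [NormedSpace ℝ E]
  {H : Type*} [TopologicalSpace H] {I : ModelWithCorners ℝ E H}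
  {M : Type*} [TopologicalSpace M] [ChartedSpace H M]
  {E' : Type*} [NormedAddCommGroup E'] [NormedSpace ℝ E'] [FiniteDimensional ℝ E']
  {H' : Type*} [TopologicalSpace H'] {I' : ModelWithCorners ℝ E' H'}
  {N : Type*} [TopologicalSpace N] [ChartedSpace H' N] [IsManifold I' ∞ N]

/-- The pullback connection `f^*D` along `f`: the covariant derivative at `x`, in the direction `v`,
of a vector field `σ` along `f`. Writing `σ = ∑ σⁱ (eᵢ ∘ f)` in the local frame `eᵢ` given by the
trivialization of the tangent bundle around `f x`, its value is
`∑ (dσⁱ)_x(v) eᵢ(f x) + ∑ σⁱ(x) D_{df(v)} eᵢ`. -/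
def covariantDerivAlong (D : CovariantDerivative I' E' (fun y : N ↦ TangentSpace I' y)) (f : M → N)
    (σ : Π y : M, TangentSpace I' (f y)) (x : M) (v : TangentSpace I x) : TangentSpace I' (f x) :=
  (trivializationAt E' (fun y : N ↦ TangentSpace I' y) (f x)).symmL ℝ (f x)
    (mvfderiv I (fun y ↦
      (trivializationAt E' (fun y : N ↦ TangentSpace I' y) (f x) ⟨f y, σ y⟩).2) x v)
  + D (extend E' (σ x)) (f x) (mfderiv I I' f x v)

lemma mvfderiv_congr {g g' : N → E'} {p : N} (h : g =ᶠ[nhds p] g') :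
    mvfderiv I' g p = mvfderiv I' g' p := by
  have := h.mfderiv_eq (I := I') (I' := 𝓘(ℝ, E'))
  exact this

lemma tensorialAt_sub_trivialization
    (D : CovariantDerivative I' E' (fun y : N ↦ TangentSpace I' y)) (p : N)
    (w : TangentSpace I' p) :
    TensorialAt I' E' (fun Z : Π y : N, TangentSpace I' y ↦ D Z p w
      - (trivializationAt E' (fun y : N ↦ TangentSpace I' y) p).symmL ℝ p
        (mvfderiv I' (fun y ↦
          (trivializationAt E' (fun y : N ↦ TangentSpace I' y) p ⟨y, Z y⟩).2) p w)) p := by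
  have hmem := mem_baseSet_trivializationAt E' (fun y : N ↦ TangentSpace I' y) p
  have hnhds := (trivializationAt E' (fun y : N ↦ TangentSpace I' y) p).open_baseSet.mem_nhds hmem
  constructor
  · intro g Z hg hZ
    have hz := (mdifferentiableAt_section I' Z).1 hZ
    have hc : (fun y ↦ (trivializationAt E' (fun y : N ↦ TangentSpace I' y) p ⟨y, (g • Z) y⟩).2)
        =ᶠ[nhds p] fun y ↦ g y •
          (trivializationAt E' (fun y : N ↦ TangentSpace I' y) p ⟨y, Z y⟩).2 := by
      filter_upwards [hnhds] with y hy
      exact ((trivializationAt E' (fun y : N ↦ TangentSpace I' y) p).linear ℝ hy).map_smul _ _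
    have hs : (trivializationAt E' (fun y : N ↦ TangentSpace I' y) p).symmL ℝ p
        (trivializationAt E' (fun y : N ↦ TangentSpace I' y) p ⟨p, Z p⟩).2 = Z p := by
      have := (trivializationAt E' (fun y : N ↦ TangentSpace I' y) p).symmL_continuousLinearMapAt
        (R := ℝ) hmem (Z p)
      rwa [Trivialization.continuousLinearMapAt_apply,
        Trivialization.linearMapAt_apply, if_pos hmem] at this
    have e1 := D.isCovariantDerivativeOnUniv.leibniz hZ hg
    have e1' : D (g • Z) p = g p • D Z p + (mvfderiv I' g p).smulRight (Z p) := e1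
    rw [mvfderiv_congr hc, mvfderiv_fun_smul hg hz, e1']
    simp only [add_apply, smul_apply, ContinuousLinearMap.smulRight_apply,
      map_add, map_smul, hs, smul_sub]
    abel
  · intro Z Z' hZ hZ'
    have hz := (mdifferentiableAt_section I' Z).1 hZ
    have hz' := (mdifferentiableAt_section I' Z').1 hZ'
    have hc : (fun y ↦ (trivializationAt E' (fun y : N ↦ TangentSpace I' y) p ⟨y, (Z + Z') y⟩).2)
        =ᶠ[nhds p] fun y ↦ (trivializationAt E' (fun y : N ↦ TangentSpace I' y) p ⟨y, Z y⟩).2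
          + (trivializationAt E' (fun y : N ↦ TangentSpace I' y) p ⟨y, Z' y⟩).2 := by
      filter_upwards [hnhds] with y hy
      exact ((trivializationAt E' (fun y : N ↦ TangentSpace I' y) p).linear ℝ hy).map_add _ _
    have e1' : D (Z + Z') p = D Z p + D Z' p := D.isCovariantDerivativeOnUniv.add hZ hZ'
    rw [mvfderiv_congr hc, mvfderiv_fun_add hz hz', e1']
    simp only [add_apply, map_add]
    abel

/-- Along the restriction of a vector field `Z` of the target, the pulled back covariant derivative
is the covariant derivative of `Z`. -/
theorem covariantDerivAlong_comp (D : CovariantDerivative I' E' (fun y : N ↦ TangentSpace I' y))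
    {f : M → N} {x : M} (hf : MDifferentiableAt I I' f x) {Z : Π y : N, TangentSpace I' y}
    (hZ : MDifferentiableAt I' (I'.prod 𝓘(ℝ, E')) (fun y ↦ TotalSpace.mk' E' y (Z y)) (f x))
    (v : TangentSpace I x) :
    covariantDerivAlong D f (fun y ↦ Z (f y)) x v = D Z (f x) (mfderiv I I' f x v) := by
  have hmem := mem_baseSet_trivializationAt E' (fun y : N ↦ TangentSpace I' y) (f x)
  have hnhds := (trivializationAt E' (fun y : N ↦ TangentSpace I' y) (f x)).open_baseSet.mem_nhds
    hmem
  have hz := (mdifferentiableAt_section I' Z).1 hZ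
  have hT := (tensorialAt_sub_trivialization D (f x) (mfderiv I I' f x v)).pointwise hZ
    (mdifferentiableAt_extend I' E' (Z (f x))) (by simp)
  have hc : (fun y ↦ (trivializationAt E' (fun y : N ↦ TangentSpace I' y) (f x)
      ⟨y, extend E' (Z (f x)) y⟩).2) =ᶠ[nhds (f x)] fun _ ↦
        (trivializationAt E' (fun y : N ↦ TangentSpace I' y) (f x) ⟨f x, Z (f x)⟩).2 := by
    filter_upwards [hnhds] with y hy
    simp only [extend]
    rw [Trivialization.apply_mk_symm _ hy]
  rw [mvfderiv_congr hc, mvfderiv_const] at hT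
  simp only [zero_apply, map_zero, sub_zero] at hT
  have hcomp : mvfderiv I (fun y ↦
      (trivializationAt E' (fun y : N ↦ TangentSpace I' y) (f x) ⟨f y, Z (f y)⟩).2) x v
      = mvfderiv I' (fun y ↦
        (trivializationAt E' (fun y : N ↦ TangentSpace I' y) (f x) ⟨y, Z y⟩).2) (f x)
          (mfderiv I I' f x v) :=
    congr($(mfderiv_comp x hz hf) v)
  rw [covariantDerivAlong, hcomp, ← hT]
  abel

end Along

section Submanifold

variable {E : Type*} [NormedAddCommGroup E] [NormedSpace ℝ E] [FiniteDimensional ℝ E]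
  {H : Type*} [TopologicalSpace H] (I : ModelWithCorners ℝ E H)
  {M : Type*} [TopologicalSpace M] [ChartedSpace H M]
  [RiemannianBundle (fun x : M ↦ TangentSpace I x)]
  {E' : Type*} [NormedAddCommGroup E'] [NormedSpace ℝ E'] [FiniteDimensional ℝ E']
  {H' : Type*} [TopologicalSpace H'] (I' : ModelWithCorners ℝ E' H')
  {N : Type*} [TopologicalSpace N] [ChartedSpace H' N]
  [RiemannianBundle (fun x : N ↦ TangentSpace I' x)]

/-- `f` is a smooth isometric immersion (its differential is injective because it preserves the
inner products). -/
structure IsIsometricImmersion (f : M → N) : Prop where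
  contMDiff : ContMDiff I I' ∞ f
  inner_mfderiv : ∀ (x : M) (u v : TangentSpace I x),
    inner ℝ (mfderiv I I' f x u) (mfderiv I I' f x v) = inner ℝ u v

/-- The tangent space `T_x M` seen inside `T_{f x} N`. -/
def tangentImage (f : M → N) (x : M) : Submodule ℝ (TangentSpace I' (f x)) :=
  (mfderiv I I' f x).range

/-- The normal space `T_x M^⊥` inside `T_{f x} N`. -/
def normalSpace (f : M → N) (x : M) : Submodule ℝ (TangentSpace I' (f x)) :=
  (tangentImage I I' f x)ᗮ

/-- The tangential component of a vector of `T_{f x} N`, as a vector of `T_x M`; see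
`IsIsometricImmersion.mfderiv_tangentialPart`. -/
def tangentialPart (f : M → N) (x : M) : TangentSpace I' (f x) →L[ℝ] TangentSpace I x :=
  ContinuousLinearMap.adjoint (mfderiv I I' f x)

variable {I I'} in
/-- For an isometric immersion, `tangentialPart` is the orthogonal projection on the tangent space
of the submanifold. -/
theorem IsIsometricImmersion.mfderiv_tangentialPart {f : M → N} (hf : IsIsometricImmersion I I' f)
    (x : M) (w : TangentSpace I' (f x)) :
    mfderiv I I' f x (tangentialPart I I' f x w) = (tangentImage I I' f x).starProjection w := by
  symm
  apply Submodule.eq_starProjection_of_mem_of_inner_eq_zero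
  · exact ⟨_, rfl⟩
  · rintro _ ⟨u, rfl⟩
    have := hf.inner_mfderiv x (tangentialPart I I' f x w) u
    have h2 := ContinuousLinearMap.adjoint_inner_left (mfderiv I I' f x) u w
    rw [inner_sub_left]
    refine sub_eq_zero.2 ?_
    refine Eq.trans ?_ this.symm
    exact h2.symm

/-- The endomorphism field `T` induced on `M` by `J`, `TX = (JX)^⊤`. -/
def inducedEndomorphism (f : M → N) (J : Π y : N, TangentSpace I' y →L[ℝ] TangentSpace I' y)
    (x : M) : TangentSpace I x →L[ℝ] TangentSpace I x :=
  tangentialPart I I' f x ∘L J (f x) ∘L mfderiv I I' f x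

/-- The vector field `TX` on `M` for a vector field `X` on `M`. On an invariant submanifold this is
`JX`, by `IsInvariant.mfderiv_inducedEndomorphism`. -/
def inducedField (f : M → N) (J : Π y : N, TangentSpace I' y →L[ℝ] TangentSpace I' y)
    (X : Π x : M, TangentSpace I x) (x : M) : TangentSpace I x :=
  inducedEndomorphism I I' f J x (X x)

/-- The submanifold is invariant: `J (T_x M) ⊆ T_x M` for every `x`. -/
def IsInvariant (f : M → N) (J : Π y : N, TangentSpace I' y →L[ℝ] TangentSpace I' y) : Prop :=
  ∀ x : M, ∀ w ∈ tangentImage I I' f x, J (f x) w ∈ tangentImage I I' f x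

variable {I I'} in
/-- On an invariant submanifold the induced endomorphism field is the restriction of `J`. -/
theorem IsInvariant.mfderiv_inducedEndomorphism {f : M → N}
    {J : Π y : N, TangentSpace I' y →L[ℝ] TangentSpace I' y} (hinv : IsInvariant I I' f J)
    (hf : IsIsometricImmersion I I' f) (x : M) (v : TangentSpace I x) :
    mfderiv I I' f x (inducedEndomorphism I I' f J x v) = J (f x) (mfderiv I I' f x v) :=
  (hf.mfderiv_tangentialPart x _).trans
    (Submodule.starProjection_eq_self_iff.2 (hinv x _ ⟨v, rfl⟩))

variable [IsManifold I' ∞ N] [IsContMDiffRiemannianBundle I' ∞ E' (fun x : N ↦ TangentSpace I' x)]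

/-- The second fundamental form `h(X, Y)` at `x`: the normal component of `∇̄_X Y`, where `∇̄` is the
Levi-Civita connection of the ambient manifold and `Y` is seen as a vector field along `f`. -/
def secondFundamentalForm (f : M → N) (X Y : Π x : M, TangentSpace I x) (x : M) :
    normalSpace I I' f x :=
  (normalSpace I I' f x).orthogonalProjectionOnto
    (covariantDerivAlong (leviCivita I' N) f (fun y ↦ mfderiv I I' f y (Y y)) x (X x))

/-- The second fundamental tensor `g(h(X, Y), ν)` at `x` corresponding to the normal vector `ν`; when
`ν` runs through an orthonormal basis of the normal space, these are the coefficients of `h(X, Y)`. -/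
def secondFundamentalTensor (f : M → N) {x : M} (ν : normalSpace I I' f x)
    (X Y : Π x : M, TangentSpace I x) : ℝ :=
  inner ℝ (secondFundamentalForm I I' f X Y x) ν

end Submanifold

end Riem

end

set_option linter.unusedSectionVars false

namespace Riem

section AlongCalculus

variable {E : Type*} [NormedAddCommGroup E] [NormedSpace ℝ E]
  {H : Type*} [TopologicalSpace H] {I : ModelWithCorners ℝ E H}
  {M : Type*} [TopologicalSpace M] [ChartedSpace H M]
  {E' : Type*} [NormedAddCommGroup E'] [NormedSpace ℝ E'] [FiniteDimensional ℝ E']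
  {H' : Type*} [TopologicalSpace H'] {I' : ModelWithCorners ℝ E' H'}
  {N : Type*} [TopologicalSpace N] [ChartedSpace H' N] [IsManifold I' ∞ N]

variable (I I') in
/-- Differentiability at `x` of a vector field `σ` along `f`. -/
def DifferentiableAlong (f : M → N) (σ : Π y : M, TangentSpace I' (f y)) (x : M) : Prop :=
  MDifferentiableAt I (I'.prod 𝓘(ℝ, E')) (fun y ↦ TotalSpace.mk' E' (f y) (σ y)) x

variable (E' I') in
/-- The coordinates of the tangent vector `w ∈ T_y N` in the trivialization around `p`. -/
noncomputable def tangentCoord (p y : N) (w : TangentSpace I' y) : E' :=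
  (trivializationAt E' (fun y : N ↦ TangentSpace I' y) p ⟨y, w⟩).2

lemma tangentCoord_zero {p y : N}
    (hy : y ∈ (trivializationAt E' (fun y : N ↦ TangentSpace I' y) p).baseSet) :
    tangentCoord E' I' p y (0 : TangentSpace I' y) = 0 :=
  ((trivializationAt E' (fun y : N ↦ TangentSpace I' y) p).linear ℝ hy).map_zero

variable {f : M → N} {σ τ : Π y : M, TangentSpace I' (f y)} {x : M}

lemma differentiableAlong_iff : DifferentiableAlong I I' f σ x ↔
    MDifferentiableAt I I' f x ∧
      MDifferentiableAt I 𝓘(ℝ, E') (fun y ↦ tangentCoord E' I' (f x) (f y) (σ y)) x :=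
  mdifferentiableAt_totalSpace _ _

lemma eventually_mem_baseSet (hf : ContinuousAt f x) : ∀ᶠ y in nhds x, f y ∈
    (trivializationAt E' (fun y : N ↦ TangentSpace I' y) (f x)).baseSet :=
  hf.preimage_mem_nhds
    ((trivializationAt E' (fun y : N ↦ TangentSpace I' y) (f x)).open_baseSet.mem_nhds
      (mem_baseSet_trivializationAt E' (fun y : N ↦ TangentSpace I' y) (f x)))

lemma tangentCoord_add {p y : N}
    (hy : y ∈ (trivializationAt E' (fun y : N ↦ TangentSpace I' y) p).baseSet)
    (v w : TangentSpace I' y) :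
    tangentCoord E' I' p y (v + w) = tangentCoord E' I' p y v + tangentCoord E' I' p y w :=
  ((trivializationAt E' (fun y : N ↦ TangentSpace I' y) p).linear ℝ hy).map_add _ _

lemma tangentCoord_smul {p y : N}
    (hy : y ∈ (trivializationAt E' (fun y : N ↦ TangentSpace I' y) p).baseSet)
    (c : ℝ) (w : TangentSpace I' y) :
    tangentCoord E' I' p y (c • w) = c • tangentCoord E' I' p y w :=
  ((trivializationAt E' (fun y : N ↦ TangentSpace I' y) p).linear ℝ hy).map_smul _ _

lemma continuousLinearMapAt_eq_tangentCoord {p y : N}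
    (hy : y ∈ (trivializationAt E' (fun y : N ↦ TangentSpace I' y) p).baseSet)
    (w : TangentSpace I' y) :
    (trivializationAt E' (fun y : N ↦ TangentSpace I' y) p).continuousLinearMapAt ℝ y w
      = tangentCoord E' I' p y w := by
  rw [Trivialization.continuousLinearMapAt_apply, Trivialization.linearMapAt_apply, if_pos hy]
  rfl

lemma symmL_tangentCoord {p y : N}
    (hy : y ∈ (trivializationAt E' (fun y : N ↦ TangentSpace I' y) p).baseSet)
    (w : TangentSpace I' y) :
    (trivializationAt E' (fun y : N ↦ TangentSpace I' y) p).symmL ℝ y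
      (tangentCoord E' I' p y w) = w := by
  rw [← continuousLinearMapAt_eq_tangentCoord hy]
  exact Trivialization.symmL_continuousLinearMapAt _ hy w

lemma tangentCoord_symmL {p y : N}
    (hy : y ∈ (trivializationAt E' (fun y : N ↦ TangentSpace I' y) p).baseSet) (c : E') :
    tangentCoord E' I' p y
      ((trivializationAt E' (fun y : N ↦ TangentSpace I' y) p).symmL ℝ y c) = c := by
  rw [← continuousLinearMapAt_eq_tangentCoord hy]
  exact Trivialization.continuousLinearMapAt_symmL _ hy c

lemma extend_eq_symmL {p : N} (w : TangentSpace I' p) {y : N}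
    (hy : y ∈ (trivializationAt E' (fun y : N ↦ TangentSpace I' y) p).baseSet) :
    (extend E' w y : TangentSpace I' y) =
      (trivializationAt E' (fun y : N ↦ TangentSpace I' y) p).symmL ℝ y
        (tangentCoord E' I' p p w) := by
  rw [Trivialization.symmL_apply _ hy]
  rfl

lemma tangentCoord_extend {p : N} (w : TangentSpace I' p) {y : N}
    (hy : y ∈ (trivializationAt E' (fun y : N ↦ TangentSpace I' y) p).baseSet) :
    tangentCoord E' I' p y (extend E' w y) = tangentCoord E' I' p p w := by
  rw [extend_eq_symmL w hy, tangentCoord_symmL hy]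

lemma eventually_mem_baseSet_self (p : N) : ∀ᶠ y in nhds p, y ∈
    (trivializationAt E' (fun y : N ↦ TangentSpace I' y) p).baseSet :=
  (trivializationAt E' (fun y : N ↦ TangentSpace I' y) p).open_baseSet.mem_nhds
    (mem_baseSet_trivializationAt E' (fun y : N ↦ TangentSpace I' y) p)

section

variable (D : CovariantDerivative I' E' (fun y : N ↦ TangentSpace I' y))

lemma covariantDerivative_extend_add {p : N} (v w : TangentSpace I' p) :
    D (extend E' (v + w)) p = D (extend E' v) p + D (extend E' w) p := by
  have h : D (extend E' v + extend E' w) p = D (extend E' v) p + D (extend E' w) p :=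
    D.isCovariantDerivativeOnUniv.add (mdifferentiableAt_extend ..) (mdifferentiableAt_extend ..)
  rw [← h]
  refine D.isCovariantDerivativeOnUniv.congr_of_eventuallyEq
    (mdifferentiableAt_extend ..)
    (mdifferentiableAt_add_section (mdifferentiableAt_extend ..) (mdifferentiableAt_extend ..))
    Filter.univ_mem ?_
  filter_upwards [eventually_mem_baseSet_self (I' := I') p] with y hy
  rw [Pi.add_apply, extend_eq_symmL _ hy, extend_eq_symmL _ hy, extend_eq_symmL _ hy,
    tangentCoord_add (mem_baseSet_trivializationAt E' (fun y : N ↦ TangentSpace I' y) p), map_add]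

lemma covariantDerivative_extend_smul {p : N} (c : ℝ) (w : TangentSpace I' p) :
    D (extend E' (c • w)) p = c • D (extend E' w) p := by
  have h : D (c • extend E' w) p = c • D (extend E' w) p :=
    D.isCovariantDerivativeOnUniv.smul_const c (mdifferentiableAt_extend ..)
  rw [← h]
  refine D.isCovariantDerivativeOnUniv.congr_of_eventuallyEq
    (mdifferentiableAt_extend ..)
    (mdifferentiableAt_const.smul_section (mdifferentiableAt_extend ..)) Filter.univ_mem ?_
  filter_upwards [eventually_mem_baseSet_self (I' := I') p] with y hy
  rw [Pi.smul_apply, extend_eq_symmL _ hy, extend_eq_symmL _ hy,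
    tangentCoord_smul (mem_baseSet_trivializationAt E' (fun y : N ↦ TangentSpace I' y) p), map_smul]

end

namespace DifferentiableAlong

lemma mdifferentiableAt (h : DifferentiableAlong I I' f σ x) : MDifferentiableAt I I' f x :=
  (differentiableAlong_iff.1 h).1

lemma coord (h : DifferentiableAlong I I' f σ x) :
    MDifferentiableAt I 𝓘(ℝ, E') (fun y ↦ tangentCoord E' I' (f x) (f y) (σ y)) x :=
  (differentiableAlong_iff.1 h).2

lemma congr (h : DifferentiableAlong I I' f σ x) (hs : ∀ᶠ y in nhds x, σ y = τ y) :
    DifferentiableAlong I I' f τ x :=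
  MDifferentiableAt.congr_of_eventuallyEq h (hs.mono fun y hy ↦ by simp only [hy])

lemma add (hs : DifferentiableAlong I I' f σ x) (ht : DifferentiableAlong I I' f τ x) :
    DifferentiableAlong I I' f (σ + τ) x := by
  refine differentiableAlong_iff.2 ⟨hs.mdifferentiableAt, ?_⟩
  refine (hs.coord.add ht.coord).congr_of_eventuallyEq ?_
  filter_upwards [eventually_mem_baseSet (I' := I') hs.mdifferentiableAt.continuousAt] with y hy
  exact tangentCoord_add hy _ _

lemma smul {g : M → ℝ} (hg : MDifferentiableAt I 𝓘(ℝ, ℝ) g x)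
    (hs : DifferentiableAlong I I' f σ x) : DifferentiableAlong I I' f (g • σ) x := by
  refine differentiableAlong_iff.2 ⟨hs.mdifferentiableAt, ?_⟩
  refine (hg.smul hs.coord).congr_of_eventuallyEq ?_
  filter_upwards [eventually_mem_baseSet (I' := I') hs.mdifferentiableAt.continuousAt] with y hy
  exact tangentCoord_smul hy _ _

lemma comp (hf : MDifferentiableAt I I' f x) {Z : Π y : N, TangentSpace I' y}
    (hZ : MDifferentiableAt I' (I'.prod 𝓘(ℝ, E')) (fun y ↦ TotalSpace.mk' E' y (Z y)) (f x)) :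
    DifferentiableAlong I I' f (fun y ↦ Z (f y)) x :=
  MDifferentiableAt.comp x hZ hf

/-- A property of vector fields along `f` that holds for the restrictions of the differentiable
vector fields of the target, and that is local, additive and stable by multiplication with
functions, holds for all differentiable vector fields along `f`. -/
theorem induction {P : (Π y : M, TangentSpace I' (f y)) → Prop}
    (h : DifferentiableAlong I I' f σ x)
    (hcongr : ∀ σ τ, DifferentiableAlong I I' f σ x → (∀ᶠ y in nhds x, σ y = τ y) → P σ → P τ)
    (hadd : ∀ σ τ, DifferentiableAlong I I' f σ x → DifferentiableAlong I I' f τ x →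
      P σ → P τ → P (σ + τ))
    (hsmul : ∀ (g : M → ℝ) σ, MDifferentiableAt I 𝓘(ℝ, ℝ) g x → DifferentiableAlong I I' f σ x →
      P σ → P (g • σ))
    (hcomp : ∀ Z : Π y : N, TangentSpace I' y,
      MDifferentiableAt I' (I'.prod 𝓘(ℝ, E')) (fun y ↦ TotalSpace.mk' E' y (Z y)) (f x) →
      P (fun y ↦ Z (f y))) : P σ := by
  classical
  have hf := h.mdifferentiableAt
  let t := trivializationAt E' (fun y : N ↦ TangentSpace I' y) (f x)
  let b := Module.finBasis ℝ E'
  let Z (i) (y : N) : TangentSpace I' y := t.symmL ℝ y (b i)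
  have hmem := mem_baseSet_trivializationAt E' (fun y : N ↦ TangentSpace I' y) (f x)
  have hZ (i) : MDifferentiableAt I' (I'.prod 𝓘(ℝ, E'))
      (fun y ↦ TotalSpace.mk' E' y (Z i y)) (f x) := by
    refine MDifferentiableAt.congr_of_eventuallyEq
      (mdifferentiableAt_extend I' E' (t.symmL ℝ (f x) (b i) : TangentSpace I' (f x))) ?_
    filter_upwards [eventually_mem_baseSet_self (I' := I') (f x)] with y hy
    rw [extend_eq_symmL _ hy, tangentCoord_symmL hmem]
  let g (i) (y : M) : ℝ := b.equivFunL (tangentCoord E' I' (f x) (f y) (σ y)) i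
  have hg (i) : MDifferentiableAt I 𝓘(ℝ, ℝ) (g i) x := by
    let L : E' →L[ℝ] ℝ := (ContinuousLinearMap.proj (R := ℝ) (φ := fun _ ↦ ℝ) i).comp b.equivFunL.toContinuousLinearMap
    exact L.differentiableAt.comp_mdifferentiableAt h.coord
  have key (s : Finset (Fin (Module.finrank ℝ E'))) :
      DifferentiableAlong I I' f (∑ i ∈ s, g i • fun y ↦ Z i (f y)) x ∧
        P (∑ i ∈ s, g i • fun y ↦ Z i (f y)) := by
    induction s using Finset.induction_on with
    | empty =>
      have h0 : MDifferentiableAt I' (I'.prod 𝓘(ℝ, E'))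
          (fun y : N ↦ TotalSpace.mk' E' y (0 : TangentSpace I' y)) (f x) :=
        mdifferentiableAt_zeroSection ..
      exact ⟨comp hf h0, hcomp _ h0⟩
    | insert i s hi ih =>
      rw [Finset.sum_insert hi]
      have h1 := smul (hg i) (comp hf (hZ i))
      exact ⟨h1.add ih.1, hadd _ _ h1 ih.1 (hsmul _ _ (hg i) (comp hf (hZ i)) (hcomp _ (hZ i)))
        ih.2⟩
  refine hcongr _ _ (key Finset.univ).1 ?_ (key Finset.univ).2
  filter_upwards [eventually_mem_baseSet (I' := I') hf.continuousAt] with y hy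
  conv_rhs => rw [← symmL_tangentCoord hy (σ y), ← b.sum_equivFun (tangentCoord E' I' _ _ _)]
  rw [map_sum, Finset.sum_apply]
  refine Finset.sum_congr rfl fun i _ ↦ ?_
  rw [map_smul]
  rfl

end DifferentiableAlong

variable (D : CovariantDerivative I' E' (fun y : N ↦ TangentSpace I' y))

lemma covariantDerivAlong_def (v : TangentSpace I x) :
    covariantDerivAlong D f σ x v =
      (trivializationAt E' (fun y : N ↦ TangentSpace I' y) (f x)).symmL ℝ (f x)
        (mvfderiv I (fun y ↦ tangentCoord E' I' (f x) (f y) (σ y)) x v)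
      + D (extend E' (σ x)) (f x) (mfderiv I I' f x v) := rfl

lemma covariantDerivAlong_congr (h : ∀ᶠ y in nhds x, σ y = τ y) (v : TangentSpace I x) :
    covariantDerivAlong D f σ x v = covariantDerivAlong D f τ x v := by
  have h1 : (fun y ↦ tangentCoord E' I' (f x) (f y) (σ y)) =ᶠ[nhds x]
      fun y ↦ tangentCoord E' I' (f x) (f y) (τ y) := h.mono fun y hy ↦ by simp only [hy]
  have h2 : mvfderiv I (fun y ↦ tangentCoord E' I' (f x) (f y) (σ y)) x
      = mvfderiv I (fun y ↦ tangentCoord E' I' (f x) (f y) (τ y)) x :=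
    h1.mfderiv_eq (I := I) (I' := 𝓘(ℝ, E'))
  rw [covariantDerivAlong_def, covariantDerivAlong_def, h2, h.self_of_nhds]

lemma covariantDerivAlong_add (hs : DifferentiableAlong I I' f σ x)
    (ht : DifferentiableAlong I I' f τ x) (v : TangentSpace I x) :
    covariantDerivAlong D f (σ + τ) x v
      = covariantDerivAlong D f σ x v + covariantDerivAlong D f τ x v := by
  have h1 : (fun y ↦ tangentCoord E' I' (f x) (f y) ((σ + τ) y)) =ᶠ[nhds x]
      fun y ↦ tangentCoord E' I' (f x) (f y) (σ y) + tangentCoord E' I' (f x) (f y) (τ y) := by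
    filter_upwards [eventually_mem_baseSet (I' := I') hs.mdifferentiableAt.continuousAt] with y hy
    exact tangentCoord_add hy _ _
  have h2 : mvfderiv I (fun y ↦ tangentCoord E' I' (f x) (f y) ((σ + τ) y)) x
      = mvfderiv I (fun y ↦ tangentCoord E' I' (f x) (f y) (σ y)
        + tangentCoord E' I' (f x) (f y) (τ y)) x :=
    h1.mfderiv_eq (I := I) (I' := 𝓘(ℝ, E'))
  simp only [covariantDerivAlong_def]
  rw [h2, mvfderiv_fun_add hs.coord ht.coord, Pi.add_apply, covariantDerivative_extend_add]
  simp only [add_apply, map_add]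
  abel

lemma covariantDerivAlong_smul {g : M → ℝ} (hg : MDifferentiableAt I 𝓘(ℝ, ℝ) g x)
    (hs : DifferentiableAlong I I' f σ x) (v : TangentSpace I x) :
    covariantDerivAlong D f (g • σ) x v
      = mvfderiv I g x v • σ x + g x • covariantDerivAlong D f σ x v := by
  have h1 : (fun y ↦ tangentCoord E' I' (f x) (f y) ((g • σ) y)) =ᶠ[nhds x]
      fun y ↦ g y • tangentCoord E' I' (f x) (f y) (σ y) := by
    filter_upwards [eventually_mem_baseSet (I' := I') hs.mdifferentiableAt.continuousAt] with y hy
    exact tangentCoord_smul hy _ _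
  have h2 : mvfderiv I (fun y ↦ tangentCoord E' I' (f x) (f y) ((g • σ) y)) x
      = mvfderiv I (fun y ↦ g y • tangentCoord E' I' (f x) (f y) (σ y)) x :=
    h1.mfderiv_eq (I := I) (I' := 𝓘(ℝ, E'))
  simp only [covariantDerivAlong_def]
  rw [h2, mvfderiv_fun_smul hg hs.coord, Pi.smul_apply', covariantDerivative_extend_smul]
  simp only [add_apply, smul_apply, map_add, map_smul, ContinuousLinearMap.smulRight_apply]
  rw [symmL_tangentCoord (mem_baseSet_trivializationAt E' (fun y : N ↦ TangentSpace I' y) (f x))]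
  module

end AlongCalculus

section AlongParallel

variable {E : Type*} [NormedAddCommGroup E] [NormedSpace ℝ E]
  {H : Type*} [TopologicalSpace H] {I : ModelWithCorners ℝ E H}
  {M : Type*} [TopologicalSpace M] [ChartedSpace H M]
  {E' : Type*} [NormedAddCommGroup E'] [NormedSpace ℝ E'] [FiniteDimensional ℝ E']
  {H' : Type*} [TopologicalSpace H'] {I' : ModelWithCorners ℝ E' H'}
  {N : Type*} [TopologicalSpace N] [ChartedSpace H' N] [IsManifold I' ∞ N]
  {f : M → N} {σ τ : Π y : M, TangentSpace I' (f y)} {x : M}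

/-- A covariant constant endomorphism field is parallel along every map. -/
theorem IsCovariantConstant.along {D : CovariantDerivative I' E' (fun y : N ↦ TangentSpace I' y)}
    {J : Π y : N, TangentSpace I' y →L[ℝ] TangentSpace I' y} (hJ : IsCovariantConstant D J)
    (hs : DifferentiableAlong I I' f σ x) :
    DifferentiableAlong I I' f (fun y ↦ J (f y) (σ y)) x ∧ ∀ v : TangentSpace I x,
      covariantDerivAlong D f (fun y ↦ J (f y) (σ y)) x v
        = J (f x) (covariantDerivAlong D f σ x v) := by
  refine hs.induction (P := fun σ ↦ DifferentiableAlong I I' f (fun y ↦ J (f y) (σ y)) x ∧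
    ∀ v : TangentSpace I x, covariantDerivAlong D f (fun y ↦ J (f y) (σ y)) x v
        = J (f x) (covariantDerivAlong D f σ x v)) ?_ ?_ ?_ ?_
  · rintro σ τ - h ⟨h1, h2⟩
    have h' : ∀ᶠ y in nhds x, J (f y) (σ y) = J (f y) (τ y) := h.mono fun y hy ↦ by rw [hy]
    refine ⟨h1.congr h', fun v ↦ ?_⟩
    rw [← covariantDerivAlong_congr D h', ← covariantDerivAlong_congr D h, h2]
  · rintro σ τ hs ht ⟨h1, h2⟩ ⟨h3, h4⟩
    have h : (fun y ↦ J (f y) ((σ + τ) y))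
        = (fun y ↦ J (f y) (σ y)) + fun y ↦ J (f y) (τ y) := funext fun y ↦ map_add _ _ _
    rw [h]
    refine ⟨h1.add h3, fun v ↦ ?_⟩
    rw [covariantDerivAlong_add D h1 h3, covariantDerivAlong_add D hs ht, map_add, h2, h4]
  · rintro g σ hg hs ⟨h1, h2⟩
    have h : (fun y ↦ J (f y) ((g • σ) y)) = g • fun y ↦ J (f y) (σ y) :=
      funext fun y ↦ map_smul _ _ _
    rw [h]
    refine ⟨h1.smul hg, fun v ↦ ?_⟩
    rw [covariantDerivAlong_smul D hg h1, covariantDerivAlong_smul D hg hs, map_add, map_smul,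
      map_smul, h2]
  · intro Z hZ
    obtain ⟨h1, h2⟩ := hJ (f x) Z hZ
    refine ⟨DifferentiableAlong.comp hs.mdifferentiableAt h1, fun v ↦ ?_⟩
    rw [covariantDerivAlong_comp D hs.mdifferentiableAt hZ, ← h2,
      covariantDerivAlong_comp D hs.mdifferentiableAt h1]

variable [RiemannianBundle (fun y : N ↦ TangentSpace I' y)]
  [IsContMDiffRiemannianBundle I' ∞ E' (fun y : N ↦ TangentSpace I' y)]

lemma DifferentiableAlong.inner (hs : DifferentiableAlong I I' f σ x)
    (ht : DifferentiableAlong I I' f τ x) :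
    MDifferentiableAt I 𝓘(ℝ, ℝ) (fun y ↦ (inner ℝ (σ y) (τ y) : ℝ)) x :=
  MDifferentiableAt.inner_bundle (F := E') (E := fun y : N ↦ TangentSpace I' y) (b := f) hs ht

/-- The pullback of the Levi-Civita connection is compatible with the metric. -/
theorem covariantDerivAlong_metric (hs : DifferentiableAlong I I' f σ x)
    (ht : DifferentiableAlong I I' f τ x) (v : TangentSpace I x) :
    mvfderiv I (fun y ↦ (inner ℝ (σ y) (τ y) : ℝ)) x v
      = inner ℝ (covariantDerivAlong (leviCivita I' N) f σ x v) (τ x)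
        + inner ℝ (σ x) (covariantDerivAlong (leviCivita I' N) f τ x v) := by
  have hf := hs.mdifferentiableAt
  have congr' {g g' : M → ℝ} (h : g =ᶠ[nhds x] g') : mvfderiv I g x = mvfderiv I g' x :=
    h.mfderiv_eq (I := I) (I' := 𝓘(ℝ, ℝ))
  refine hs.induction (P := fun σ ↦ mvfderiv I (fun y ↦ (Inner.inner ℝ (σ y) (τ y) : ℝ)) x v
      = Inner.inner ℝ (covariantDerivAlong (leviCivita I' N) f σ x v) (τ x)
        + Inner.inner ℝ (σ x) (covariantDerivAlong (leviCivita I' N) f τ x v)) ?_ ?_ ?_ ?_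
  · intro σ σ' _ h h1
    rw [← covariantDerivAlong_congr _ h, ← h.self_of_nhds, ← h1]
    exact congrFun (congrArg _ (congr' (h.mono fun y hy ↦ by simp only [hy])).symm) v
  · intro σ σ' hs hs' h1 h2
    have h : (fun y ↦ (Inner.inner ℝ ((σ + σ') y) (τ y) : ℝ))
        = fun y ↦ Inner.inner ℝ (σ y) (τ y) + Inner.inner ℝ (σ' y) (τ y) :=
      funext fun y ↦ inner_add_left _ _ _
    rw [h, mvfderiv_fun_add (hs.inner ht) (hs'.inner ht), covariantDerivAlong_add _ hs hs', add_apply,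
      h1, h2, Pi.add_apply, inner_add_left, inner_add_left]
    ring
  · intro g σ hg hs h1
    have h : (fun y ↦ (Inner.inner ℝ ((g • σ) y) (τ y) : ℝ))
        = fun y ↦ g y * Inner.inner ℝ (σ y) (τ y) :=
      funext fun y ↦ real_inner_smul_left _ _ _
    rw [h, mvfderiv_fun_mul hg (hs.inner ht), covariantDerivAlong_smul _ hg hs, add_apply,
      smul_apply, smul_apply, h1, Pi.smul_apply', inner_add_left, real_inner_smul_left,
      real_inner_smul_left, real_inner_smul_left, smul_eq_mul, smul_eq_mul]
    ring
  intro Z hZ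
  have hZf := DifferentiableAlong.comp hf hZ
  refine ht.induction (P := fun τ ↦ mvfderiv I (fun y ↦ (Inner.inner ℝ (Z (f y)) (τ y) : ℝ)) x v
      = Inner.inner ℝ (covariantDerivAlong (leviCivita I' N) f (fun y ↦ Z (f y)) x v) (τ x)
        + Inner.inner ℝ (Z (f x)) (covariantDerivAlong (leviCivita I' N) f τ x v)) ?_ ?_ ?_ ?_
  · intro τ τ' _ h h1
    rw [← covariantDerivAlong_congr _ h, ← h.self_of_nhds, ← h1]
    exact congrFun (congrArg _ (congr' (h.mono fun y hy ↦ by simp only [hy])).symm) v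
  · intro τ τ' ht ht' h1 h2
    have h : (fun y ↦ (Inner.inner ℝ (Z (f y)) ((τ + τ') y) : ℝ))
        = fun y ↦ Inner.inner ℝ (Z (f y)) (τ y) + Inner.inner ℝ (Z (f y)) (τ' y) :=
      funext fun y ↦ inner_add_right _ _ _
    rw [h, mvfderiv_fun_add (hZf.inner ht) (hZf.inner ht'), covariantDerivAlong_add _ ht ht',
      add_apply, h1, h2, Pi.add_apply, inner_add_right, inner_add_right]
    ring
  · intro g τ hg ht h1
    have h : (fun y ↦ (Inner.inner ℝ (Z (f y)) ((g • τ) y) : ℝ))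
        = fun y ↦ g y * Inner.inner ℝ (Z (f y)) (τ y) :=
      funext fun y ↦ real_inner_smul_right _ _ _
    rw [h, mvfderiv_fun_mul hg (hZf.inner ht), covariantDerivAlong_smul _ hg ht, add_apply,
      smul_apply, smul_apply, h1, Pi.smul_apply', inner_add_right, real_inner_smul_right,
      real_inner_smul_right, real_inner_smul_right, smul_eq_mul, smul_eq_mul]
    ring
  · intro W hW
    rw [covariantDerivAlong_comp _ hf hZ, covariantDerivAlong_comp _ hf hW]
    have h1 := leviCivita_metric (X := extend E' (mfderiv I I' f x v))
      (mdifferentiableAt_extend ..) hZ hW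
    rw [extend_apply_self] at h1
    rw [← h1]
    exact mvfderiv_comp_apply x (mdifferentiableAt_inner hZ hW) hf v

end AlongParallel

section BracketAsCommutator

variable {E : Type*} [NormedAddCommGroup E] [NormedSpace ℝ E] [FiniteDimensional ℝ E]
  {H : Type*} [TopologicalSpace H] {I : ModelWithCorners ℝ E H} [I.Boundaryless]
  {M : Type*} [TopologicalSpace M] [ChartedSpace H M] [IsManifold I ∞ M]
  {G : Type*} [NormedAddCommGroup G] [NormedSpace ℝ G]
  {F : M → G} {V W : Π x : M, TangentSpace I x} {x : M}

variable (I) in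
/-- The vector field `V` read in the extended chart around `x`. -/
noncomputable def chartField (x : M) (V : Π x : M, TangentSpace I x) : E → E :=
  mpullbackWithin 𝓘(ℝ, E) I (extChartAt I x).symm V (Set.range I)

lemma fderiv_comp_extChartAt_symm {y : M} (hy : y ∈ (extChartAt I x).source)
    (hF : MDifferentiableAt I 𝓘(ℝ, G) F y) (V : Π x : M, TangentSpace I x) :
    fderiv ℝ (F ∘ (extChartAt I x).symm) (extChartAt I x y) (chartField I x V (extChartAt I x y))
      = mvfderiv I F y (V y) := by
  obtain ⟨z, hz, rfl⟩ : ∃ z ∈ (extChartAt I x).target, (extChartAt I x).symm z = y :=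
    ⟨extChartAt I x y, (extChartAt I x).map_source hy, (extChartAt I x).left_inv hy⟩
  rw [(extChartAt I x).right_inv hz]
  have hu : Set.range I = Set.univ := I.range_eq_univ
  have hc := mdifferentiableWithinAt_extChartAt_symm (I := I) hz
  have hi := isInvertible_mfderivWithin_extChartAt_symm (I := I) hz
  have h1 := mfderiv_comp_mfderivWithin (I := 𝓘(ℝ, E)) (I' := I) (I'' := 𝓘(ℝ, G)) z hF hc
    (by rw [hu]; exact uniqueMDiffWithinAt_univ _)
  have h2 : fderiv ℝ (F ∘ (extChartAt I x).symm) z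
      = mfderivWithin 𝓘(ℝ, E) 𝓘(ℝ, G) (F ∘ (extChartAt I x).symm) (Set.range I) z := by
    rw [hu, mfderivWithin_univ, mfderiv_eq_fderiv]
  rw [h2, h1]
  exact congrArg _ (hi.self_apply_inverse (V ((extChartAt I x).symm z)))

lemma differentiableAt_chartField (hV : MDiffAt (T% V) x) :
    DifferentiableAt ℝ (chartField I x V) (extChartAt I x x) := by
  have h : DifferentiableWithinAt ℝ (chartField I x V)
      ((extChartAt I x).symm ⁻¹' Set.univ ∩ Set.range I) (extChartAt I x x) :=
    hV.mdifferentiableWithinAt.differentiableWithinAt_mpullbackWithin_vectorField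
  rwa [I.range_eq_univ, Set.preimage_univ, Set.univ_inter, differentiableWithinAt_univ] at h

lemma eventually_mvfderiv_eq (hF : ContMDiffAt I 𝓘(ℝ, G) 2 F x) (V : Π x : M, TangentSpace I x) :
    (fun y ↦ mvfderiv I F y (V y)) =ᶠ[nhds x] (fun z ↦ fderiv ℝ (F ∘ (extChartAt I x).symm) z
      (chartField I x V z)) ∘ extChartAt I x := by
  filter_upwards [extChartAt_source_mem_nhds (I := I) x, (contMDiffAt_iff_contMDiffAt_nhds (by decide)).1 hF] with y hy hF'
  exact (fderiv_comp_extChartAt_symm hy (hF'.mdifferentiableAt (by norm_num)) V).symm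

lemma contDiffAt_comp_extChartAt_symm (hF : ContMDiffAt I 𝓘(ℝ, G) 2 F x) :
    ContDiffAt ℝ 2 (F ∘ (extChartAt I x).symm) (extChartAt I x x) := by
  have := contMDiffAt_iff_source.1 hF
  rw [I.range_eq_univ] at this
  exact this.contDiffWithinAt.contDiffAt Filter.univ_mem

lemma hasFDerivAt_fderiv_chartField (hF : ContMDiffAt I 𝓘(ℝ, G) 2 F x) (hV : MDiffAt (T% V) x) :
    HasFDerivAt (fun z ↦ fderiv ℝ (F ∘ (extChartAt I x).symm) z (chartField I x V z))
      ((fderiv ℝ (F ∘ (extChartAt I x).symm) (extChartAt I x x)).comp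
        (fderiv ℝ (chartField I x V) (extChartAt I x x))
        + (fderiv ℝ (fderiv ℝ (F ∘ (extChartAt I x).symm)) (extChartAt I x x)).flip
          (chartField I x V (extChartAt I x x))) (extChartAt I x x) :=
  ((contDiffAt_comp_extChartAt_symm hF).fderiv_right (m := 1)
    (by norm_num)).differentiableAt (by norm_num) |>.hasFDerivAt.clm_apply
      (differentiableAt_chartField hV).hasFDerivAt

/-- The derivative of a `C^2` function along a differentiable vector field is differentiable. -/
lemma mdifferentiableAt_mvfderiv (hF : ContMDiffAt I 𝓘(ℝ, G) 2 F x) (hV : MDiffAt (T% V) x) :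
    MDifferentiableAt I 𝓘(ℝ, G) (fun y ↦ mvfderiv I F y (V y)) x := by
  refine MDifferentiableAt.congr_of_eventuallyEq ?_ (eventually_mvfderiv_eq hF V)
  exact (hasFDerivAt_fderiv_chartField hF hV).differentiableAt.comp_mdifferentiableAt
    (mdifferentiableAt_extChartAt (mem_chart_source H x))

lemma mvfderiv_mvfderiv (hF : ContMDiffAt I 𝓘(ℝ, G) 2 F x) (hV : MDiffAt (T% V) x)
    (W : Π x : M, TangentSpace I x) :
    mvfderiv I (fun y ↦ mvfderiv I F y (V y)) x (W x) =
      fderiv ℝ (F ∘ (extChartAt I x).symm) (extChartAt I x x)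
        (fderiv ℝ (chartField I x V) (extChartAt I x x) (chartField I x W (extChartAt I x x)))
      + fderiv ℝ (fderiv ℝ (F ∘ (extChartAt I x).symm)) (extChartAt I x x)
        (chartField I x W (extChartAt I x x)) (chartField I x V (extChartAt I x x)) := by
  rw [← fderiv_comp_extChartAt_symm (mem_extChartAt_source x) (mdifferentiableAt_mvfderiv hF hV) W]
  have h : (fun y ↦ mvfderiv I F y (V y)) ∘ (extChartAt I x).symm =ᶠ[nhds (extChartAt I x x)]
      fun z ↦ fderiv ℝ (F ∘ (extChartAt I x).symm) z (chartField I x V z) := by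
    have h0 := continuousAt_extChartAt_symm (I := I) x
    rw [ContinuousAt, extChartAt_to_inv] at h0
    have h1 := h0.eventually (eventually_mvfderiv_eq hF V)
    filter_upwards [h1, extChartAt_target_mem_nhds (I := I) x] with z hz hz'
    refine (show _ = _ from hz).trans ?_
    simp only [Function.comp_apply]
    rw [(extChartAt I x).right_inv hz']
  rw [h.fderiv_eq, (hasFDerivAt_fderiv_chartField hF hV).fderiv]
  rfl

/-- The Lie bracket acts on `C^2` functions as a commutator. -/
theorem mvfderiv_mlieBracket (hF : ContMDiffAt I 𝓘(ℝ, G) 2 F x) (hV : MDiffAt (T% V) x)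
    (hW : MDiffAt (T% W) x) :
    mvfderiv I F x (mlieBracket I V W x) = mvfderiv I (fun y ↦ mvfderiv I F y (W y)) x (V x)
      - mvfderiv I (fun y ↦ mvfderiv I F y (V y)) x (W x) := by
  have hd := contDiffAt_comp_extChartAt_symm hF
  have hsymm := hd.isSymmSndFDerivAt (by simp)
  have hF1 : F =ᶠ[nhds x] (F ∘ (extChartAt I x).symm) ∘ extChartAt I x := by
    filter_upwards [extChartAt_source_mem_nhds (I := I) x] with y hy
    simp only [Function.comp_apply]
    rw [(extChartAt I x).left_inv hy]
  have h1 : mvfderiv I F x (mlieBracket I V W x)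
      = fderiv ℝ (F ∘ (extChartAt I x).symm) (extChartAt I x x)
        (mfderiv I 𝓘(ℝ, E) (extChartAt I x) x (mlieBracket I V W x)) := by
    have h2 : mvfderiv I F x = mvfderiv I ((F ∘ (extChartAt I x).symm) ∘ extChartAt I x) x :=
      hF1.mfderiv_eq (I := I) (I' := 𝓘(ℝ, G))
    rw [h2]
    refine (mfderiv_comp_apply (I' := 𝓘(ℝ, E)) (I'' := 𝓘(ℝ, G)) x
      (hd.differentiableAt (by norm_num)).mdifferentiableAt
      (mdifferentiableAt_extChartAt (mem_chart_source H x)) _).trans ?_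
    rw [mfderiv_eq_fderiv]
    rfl
  have h3 : mfderiv I 𝓘(ℝ, E) (extChartAt I x) x (mlieBracket I V W x)
      = lieBracket ℝ (chartField I x V) (chartField I x W) (extChartAt I x x) := by
    have h4 : lieBracketWithin ℝ (chartField I x V) (chartField I x W)
        ((extChartAt I x).symm ⁻¹' Set.univ ∩ Set.range I) (extChartAt I x x)
        = lieBracket ℝ (chartField I x V) (chartField I x W) (extChartAt I x x) := by
      rw [I.range_eq_univ, Set.preimage_univ, Set.univ_inter, lieBracketWithin_univ]
    rw [← h4]
    exact (isInvertible_mfderiv_extChartAt (mem_extChartAt_source x)).self_apply_inverse _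
  rw [h1, h3, mvfderiv_mvfderiv hF hV, mvfderiv_mvfderiv hF hW, lieBracket_eq, map_sub,
    hsymm (chartField I x V (extChartAt I x x)) (chartField I x W (extChartAt I x x))]
  abel

end BracketAsCommutator

section TorsionAlong

variable {E : Type*} [NormedAddCommGroup E] [NormedSpace ℝ E] [FiniteDimensional ℝ E]
  {H : Type*} [TopologicalSpace H] {I : ModelWithCorners ℝ E H} [I.Boundaryless]
  {M : Type*} [TopologicalSpace M] [ChartedSpace H M] [IsManifold I ∞ M]
  {E' : Type*} [NormedAddCommGroup E'] [NormedSpace ℝ E'] [FiniteDimensional ℝ E']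
  {H' : Type*} [TopologicalSpace H'] {I' : ModelWithCorners ℝ E' H'} [I'.Boundaryless]
  {N : Type*} [TopologicalSpace N] [ChartedSpace H' N] [IsManifold I' ∞ N]
  {f : M → N} {X Y : Π y : M, TangentSpace I y} {x : M}

lemma tangentCoord_eq_mvfderiv {p y : N} (hy : y ∈ (chartAt H' p).source)
    (w : TangentSpace I' y) :
    tangentCoord E' I' p y w = mvfderiv I' (extChartAt I' p) y w := by
  have h := TangentBundle.continuousLinearMapAt_trivializationAt (I := I') hy
  have hy' : y ∈ (trivializationAt E' (fun y : N ↦ TangentSpace I' y) p).baseSet := by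
    rwa [TangentBundle.trivializationAt_baseSet]
  rw [← continuousLinearMapAt_eq_tangentCoord hy']
  exact congr($h w)

lemma contMDiffAt_extChartAt_comp (hf : ContMDiffAt I I' ∞ f x) :
    ContMDiffAt I 𝓘(ℝ, E') 2 (extChartAt I' (f x) ∘ f) x :=
  (contMDiffAt_extChartAt.comp x hf).of_le (WithTop.coe_le_coe.2 le_top)

lemma eventually_tangentCoord_mfderiv (hf : ContMDiff I I' ∞ f) (Y : Π y : M, TangentSpace I y)
    (x : M) :
    (fun y ↦ tangentCoord E' I' (f x) (f y) (mfderiv I I' f y (Y y))) =ᶠ[nhds x]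
      fun y ↦ mvfderiv I (extChartAt I' (f x) ∘ f) y (Y y) := by
  filter_upwards [hf.continuous.continuousAt.preimage_mem_nhds
    (chart_source_mem_nhds H' (f x))] with y hy
  rw [tangentCoord_eq_mvfderiv hy]
  exact (mfderiv_comp_apply (I' := I') (I'' := 𝓘(ℝ, E')) y (mdifferentiableAt_extChartAt hy)
    (hf.mdifferentiableAt (by simp)) (Y y)).symm

/-- The image under `df` of a differentiable vector field is differentiable along `f`. -/
theorem differentiableAlong_mfderiv (hf : ContMDiff I I' ∞ f) (hY : MDiffAt (T% Y) x) :
    DifferentiableAlong I I' f (fun y ↦ mfderiv I I' f y (Y y)) x :=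
  differentiableAlong_iff.2 ⟨hf.mdifferentiableAt (by simp),
    (mdifferentiableAt_mvfderiv (contMDiffAt_extChartAt_comp hf.contMDiffAt) hY
      ).congr_of_eventuallyEq (eventually_tangentCoord_mfderiv hf Y x)⟩

lemma mlieBracket_extend (p : N) (v w : TangentSpace I' p) :
    mlieBracket I' (extend E' v) (extend E' w) p = 0 := by
  have hF : ContMDiffAt I' 𝓘(ℝ, E') 2 (extChartAt I' p) p :=
    contMDiffAt_extChartAt
  have hconst (u : TangentSpace I' p) :
      (fun y ↦ mvfderiv I' (extChartAt I' p) y (extend E' u y)) =ᶠ[nhds p]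
        fun _ ↦ tangentCoord E' I' p p u := by
    filter_upwards [chart_source_mem_nhds H' p, eventually_mem_baseSet_self (I' := I') p]
      with y hy hy'
    rw [← tangentCoord_eq_mvfderiv hy, tangentCoord_extend u hy']
  have h := mvfderiv_mlieBracket hF (mdifferentiableAt_extend I' E' v)
    (mdifferentiableAt_extend I' E' w)
  rw [mvfderiv_congr (hconst v), mvfderiv_congr (hconst w), mvfderiv_const, mvfderiv_const,
    zero_apply, zero_apply, sub_zero] at h
  exact (isInvertible_mfderiv_extChartAt (mem_extChartAt_source p)).injective
    (h.trans (map_zero _).symm)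

lemma covariantDerivative_extend_comm {D : CovariantDerivative I' E' (fun y : N ↦ TangentSpace I' y)}
    (hD : D.torsion = 0) (p : N) (v w : TangentSpace I' p) :
    D (extend E' w) p v = D (extend E' v) p w := by
  have h := D.torsion_apply_eq_extend v w
  rw [hD, mlieBracket_extend, extend_apply_self, extend_apply_self, sub_zero] at h
  exact sub_eq_zero.1 h.symm

/-- The pullback of a torsion-free connection is symmetric. -/
theorem covariantDerivAlong_mfderiv_sub
    {D : CovariantDerivative I' E' (fun y : N ↦ TangentSpace I' y)} (hD : D.torsion = 0)
    (hf : ContMDiff I I' ∞ f) (hX : MDiffAt (T% X) x) (hY : MDiffAt (T% Y) x) :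
    covariantDerivAlong D f (fun y ↦ mfderiv I I' f y (Y y)) x (X x)
      - covariantDerivAlong D f (fun y ↦ mfderiv I I' f y (X y)) x (Y x)
      = mfderiv I I' f x (mlieBracket I X Y x) := by
  have hc (Z : Π y : M, TangentSpace I y) :
      mvfderiv I (fun y ↦ tangentCoord E' I' (f x) (f y) (mfderiv I I' f y (Z y))) x
      = mvfderiv I (fun y ↦ mvfderiv I (extChartAt I' (f x) ∘ f) y (Z y)) x :=
    (eventually_tangentCoord_mfderiv hf Z x).mfderiv_eq (I := I) (I' := 𝓘(ℝ, E'))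
  have h := mvfderiv_mlieBracket (contMDiffAt_extChartAt_comp (hf.contMDiffAt (x := x))) hX hY
  have h1 : tangentCoord E' I' (f x) (f x) (mfderiv I I' f x (mlieBracket I X Y x))
      = mvfderiv I (extChartAt I' (f x) ∘ f) x (mlieBracket I X Y x) :=
    (eventually_tangentCoord_mfderiv hf (mlieBracket I X Y) x).self_of_nhds
  rw [covariantDerivAlong_def, covariantDerivAlong_def, covariantDerivative_extend_comm hD,
    add_sub_add_right_eq_sub, ← map_sub, hc, hc, ← h, ← h1]
  exact symmL_tangentCoord
    (mem_baseSet_trivializationAt E' (fun y : N ↦ TangentSpace I' y) (f x)) _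

/-- For an immersion `f`, a vector field is differentiable if its image under `df` is. -/
theorem mdifferentiableAt_of_differentiableAlong_mfderiv (hf : ContMDiff I I' ∞ f)
    (hinj : Function.Injective (mfderiv I I' f x))
    (hY : DifferentiableAlong I I' f (fun y ↦ mfderiv I I' f y (Y y)) x) :
    MDiffAt (T% Y) x := by
  rw [mdifferentiableAt_section]
  let A : M → E →L[ℝ] E' := inTangentCoordinates I I' id f (mfderiv I I' f) x
  have hA : MDifferentiableAt I 𝓘(ℝ, E →L[ℝ] E') A x :=
    ((hf.contMDiffAt (x := x)).mfderiv_const (m := 1) (WithTop.coe_le_coe.2 le_top)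
      ).mdifferentiableAt (by norm_num)
  have hAY (Z : Π y : M, TangentSpace I y) : ∀ᶠ y in nhds x,
      A y (tangentCoord E I x y (Z y)) = tangentCoord E' I' (f x) (f y) (mfderiv I I' f y (Z y)) := by
    filter_upwards [eventually_mem_baseSet_self (I' := I) x,
      eventually_mem_baseSet (I' := I') hf.continuous.continuousAt] with y hy hy'
    rw [← continuousLinearMapAt_eq_tangentCoord hy']
    refine congrArg (fun u ↦ (trivializationAt E' (fun y : N ↦ TangentSpace I' y)
      (f x)).continuousLinearMapAt ℝ (f y) (mfderiv I I' f y u)) ?_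
    exact symmL_tangentCoord hy (Z y)
  have hAinj : Function.Injective (A x) := by
    refine (injective_iff_map_eq_zero _).2 fun c hc ↦ ?_
    have hm := mem_baseSet_trivializationAt E (fun y : M ↦ TangentSpace I y) x
    have hm' := mem_baseSet_trivializationAt E' (fun y : N ↦ TangentSpace I' y) (f x)
    let u : TangentSpace I x := (trivializationAt E (fun y : M ↦ TangentSpace I y) x).symmL ℝ x c
    have h1 := (hAY (extend E u)).self_of_nhds
    rw [extend_apply_self, tangentCoord_symmL hm, hc] at h1
    have h2 : mfderiv I I' f x u = 0 := by
      rw [← symmL_tangentCoord hm' (mfderiv I I' f x u), ← h1, map_zero]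
    have h3 : u = 0 := hinj (h2.trans (map_zero _).symm)
    rw [← tangentCoord_symmL hm c]
    change tangentCoord E I x x u = 0
    rw [h3, tangentCoord_zero hm]
  obtain ⟨L, hL⟩ := (A x : E →ₗ[ℝ] E').exists_leftInverse_of_injective
    (LinearMap.ker_eq_bot.2 hAinj)
  let L' : E' →L[ℝ] E := L.toContinuousLinearMap
  let B : M → E →L[ℝ] E := fun y ↦ L'.comp (A y)
  have hB : MDifferentiableAt I 𝓘(ℝ, E →L[ℝ] E) B x :=
    mdifferentiableAt_const.clm_comp hA
  have hBx : B x = (ContinuousLinearEquiv.refl ℝ E : E →L[ℝ] E) := by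
    ext c
    exact congr($hL c)
  have hBi : MDifferentiableAt I 𝓘(ℝ, E →L[ℝ] E) (fun y ↦ (B y).inverse) x := by
    have h1 : DifferentiableAt ℝ (ContinuousLinearMap.inverse : (E →L[ℝ] E) → _) (B x) := by
      rw [hBx]
      exact (contDiffAt_map_inverse (n := 1) _).differentiableAt (by norm_num)
    exact h1.comp_mdifferentiableAt hB
  have hinv : ∀ᶠ y in nhds x, (B y).IsInvertible := by
    have h1 : ∀ᶠ C in nhds (B x), C.IsInvertible := by
      rw [hBx]
      exact ContinuousLinearEquiv.nhds _
    exact hB.continuousAt.eventually h1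
  refine (hBi.clm_apply (L'.differentiableAt.comp_mdifferentiableAt hY.coord)
    ).congr_of_eventuallyEq ?_
  filter_upwards [hinv, hAY Y] with y hy hy'
  rw [Function.comp_apply, ← hy']
  exact (hy.inverse_apply_self _).symm

end TorsionAlong

section Gauss

variable {E : Type*} [NormedAddCommGroup E] [NormedSpace ℝ E] [FiniteDimensional ℝ E]
  {H : Type*} [TopologicalSpace H] {I : ModelWithCorners ℝ E H} [I.Boundaryless]
  {M : Type*} [TopologicalSpace M] [ChartedSpace H M] [IsManifold I ∞ M]
  [RiemannianBundle (fun x : M ↦ TangentSpace I x)]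
  [IsContMDiffRiemannianBundle I ∞ E (fun x : M ↦ TangentSpace I x)]
  {E' : Type*} [NormedAddCommGroup E'] [NormedSpace ℝ E'] [FiniteDimensional ℝ E']
  {H' : Type*} [TopologicalSpace H'] {I' : ModelWithCorners ℝ E' H'} [I'.Boundaryless]
  {N : Type*} [TopologicalSpace N] [ChartedSpace H' N] [IsManifold I' ∞ N]
  [RiemannianBundle (fun y : N ↦ TangentSpace I' y)]
  [IsContMDiffRiemannianBundle I' ∞ E' (fun y : N ↦ TangentSpace I' y)]
  {f : M → N} {X Y : Π y : M, TangentSpace I y} {x : M}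

lemma IsIsometricImmersion.injective_mfderiv (hf : IsIsometricImmersion I I' f) (x : M) :
    Function.Injective (mfderiv I I' f x) := by
  refine (injective_iff_map_eq_zero _).2 fun v hv ↦ ?_
  rw [← inner_self_eq_zero (𝕜 := ℝ), ← hf.inner_mfderiv x v v]
  simp only [hv, inner_zero_left]

/-- The Gauss formula: the tangential part of the ambient covariant derivative is the covariant
derivative of the induced metric. -/
theorem IsIsometricImmersion.inner_covariantDerivAlong (hf : IsIsometricImmersion I I' f)
    (hY : MDiffAt (T% Y) x) (v w : TangentSpace I x) :
    inner ℝ (covariantDerivAlong (leviCivita I' N) f (fun y ↦ mfderiv I I' f y (Y y)) x v)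
      (mfderiv I I' f x w) = inner ℝ (leviCivita I M Y x v) w := by
  obtain ⟨X, hX, rfl⟩ : ∃ X : Π y : M, TangentSpace I y, MDiffAt (T% X) x ∧ X x = v :=
    ⟨extend E v, mdifferentiableAt_extend .., extend_apply_self E v⟩
  obtain ⟨Z, hZ, rfl⟩ : ∃ Z : Π y : M, TangentSpace I y, MDiffAt (T% Z) x ∧ Z x = w :=
    ⟨extend E w, mdifferentiableAt_extend .., extend_apply_self E w⟩
  have metric {U V : Π y : M, TangentSpace I y} (hU : MDiffAt (T% U) x) (hV : MDiffAt (T% V) x)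
      (u : TangentSpace I x) : mvfderiv I (fun y ↦ (inner ℝ (U y) (V y) : ℝ)) x u =
      inner ℝ (covariantDerivAlong (leviCivita I' N) f (fun y ↦ mfderiv I I' f y (U y)) x u)
        (mfderiv I I' f x (V x)) +
      inner ℝ (covariantDerivAlong (leviCivita I' N) f (fun y ↦ mfderiv I I' f y (V y)) x u)
        (mfderiv I I' f x (U x)) := by
    have h : (fun y ↦ (inner ℝ (U y) (V y) : ℝ))
        = fun y ↦ inner ℝ (mfderiv I I' f y (U y)) (mfderiv I I' f y (V y)) :=
      funext fun y ↦ (hf.inner_mfderiv y _ _).symm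
    rw [h, covariantDerivAlong_metric (differentiableAlong_mfderiv hf.contMDiff hU)
      (differentiableAlong_mfderiv hf.contMDiff hV), real_inner_comm (mfderiv I I' f x (U x))]
  have bracket {U V : Π y : M, TangentSpace I y} (hU : MDiffAt (T% U) x) (hV : MDiffAt (T% V) x)
      (u : TangentSpace I x) : inner ℝ (mlieBracket I U V x) u =
      inner ℝ (covariantDerivAlong (leviCivita I' N) f (fun y ↦ mfderiv I I' f y (V y)) x (U x))
        (mfderiv I I' f x u) -
      inner ℝ (covariantDerivAlong (leviCivita I' N) f (fun y ↦ mfderiv I I' f y (U y)) x (V x))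
        (mfderiv I I' f x u) := by
    rw [← inner_sub_left, covariantDerivAlong_mfderiv_sub leviCivita_torsion hf.contMDiff hU hV,
      hf.inner_mfderiv]
  have hk : inner ℝ (leviCivita I M Y x (X x)) (Z x) = koszul I X Y Z x :=
    inner_leviCivitaFun hX hY hZ
  rw [hk, koszul, metric hY hZ, metric hX hZ, metric hX hY, bracket hX hY, bracket hX hZ,
    bracket hY hZ]
  ring

/-- The second fundamental form is symmetric. -/
theorem secondFundamentalForm_comm (hf : ContMDiff I I' ∞ f) (hX : MDiffAt (T% X) x)
    (hY : MDiffAt (T% Y) x) :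
    secondFundamentalForm I I' f X Y x = secondFundamentalForm I I' f Y X x := by
  rw [secondFundamentalForm, secondFundamentalForm, ← sub_eq_zero, ← map_sub,
    covariantDerivAlong_mfderiv_sub leviCivita_torsion hf hX hY]
  refine (Submodule.orthogonalProjectionOnto_eq_zero_iff).2 ?_
  exact Submodule.le_orthogonal_orthogonal _ ⟨_, rfl⟩

end Gauss

section Invariant

variable {E : Type*} [NormedAddCommGroup E] [NormedSpace ℝ E] [FiniteDimensional ℝ E]
  {H : Type*} [TopologicalSpace H] {I : ModelWithCorners ℝ E H} [I.Boundaryless]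
  {M : Type*} [TopologicalSpace M] [ChartedSpace H M] [IsManifold I ∞ M]
  [RiemannianBundle (fun x : M ↦ TangentSpace I x)]
  [IsContMDiffRiemannianBundle I ∞ E (fun x : M ↦ TangentSpace I x)]
  {E' : Type*} [NormedAddCommGroup E'] [NormedSpace ℝ E'] [FiniteDimensional ℝ E']
  {H' : Type*} [TopologicalSpace H'] {I' : ModelWithCorners ℝ E' H'} [I'.Boundaryless]
  {N : Type*} [TopologicalSpace N] [ChartedSpace H' N] [IsManifold I' ∞ N]
  [RiemannianBundle (fun y : N ↦ TangentSpace I' y)]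
  [IsContMDiffRiemannianBundle I' ∞ E' (fun y : N ↦ TangentSpace I' y)]
  {f : M → N} {X Y : Π y : M, TangentSpace I y} {x : M} {p q : ℕ}
  {J : Π y : N, TangentSpace I' y →L[ℝ] TangentSpace I' y}

lemma IsInvariant.mfderiv_inducedField (hinv : IsInvariant I I' f J)
    (hf : IsIsometricImmersion I I' f) (Y : Π y : M, TangentSpace I y) :
    (fun y ↦ mfderiv I I' f y (inducedField I I' f J Y y))
      = fun y ↦ J (f y) (mfderiv I I' f y (Y y)) :=
  funext fun y ↦ hinv.mfderiv_inducedEndomorphism hf y (Y y)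

lemma IsLocallyMetallic.differentiableAlong (hJ : IsLocallyMetallic p q J)
    (hf : IsIsometricImmersion I I' f) (hinv : IsInvariant I I' f J) (hY : MDiffAt (T% Y) x) :
    DifferentiableAlong I I' f (fun y ↦ mfderiv I I' f y (inducedField I I' f J Y y)) x := by
  rw [hinv.mfderiv_inducedField hf]
  exact (hJ.covariantConstant.along (differentiableAlong_mfderiv hf.contMDiff hY)).1

lemma IsLocallyMetallic.covariantDerivAlong_inducedField (hJ : IsLocallyMetallic p q J)
    (hf : IsIsometricImmersion I I' f) (hinv : IsInvariant I I' f J) (hY : MDiffAt (T% Y) x)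
    (v : TangentSpace I x) :
    covariantDerivAlong (leviCivita I' N) f
      (fun y ↦ mfderiv I I' f y (inducedField I I' f J Y y)) x v
      = J (f x) (covariantDerivAlong (leviCivita I' N) f (fun y ↦ mfderiv I I' f y (Y y)) x v) := by
  rw [hinv.mfderiv_inducedField hf]
  exact (hJ.covariantConstant.along (differentiableAlong_mfderiv hf.contMDiff hY)).2 v

lemma IsLocallyMetallic.mdifferentiableAt_inducedField (hJ : IsLocallyMetallic p q J)
    (hf : IsIsometricImmersion I I' f) (hinv : IsInvariant I I' f J) (hY : MDiffAt (T% Y) x) :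
    MDiffAt (T% (inducedField I I' f J Y)) x :=
  mdifferentiableAt_of_differentiableAlong_mfderiv hf.contMDiff (hf.injective_mfderiv x)
    (hJ.differentiableAlong hf hinv hY)

lemma IsMetallicRiemannian.inner_inducedEndomorphism_comm (hJ : IsMetallicRiemannian p q J)
    (hf : IsIsometricImmersion I I' f) (hinv : IsInvariant I I' f J) (v w : TangentSpace I x) :
    inner ℝ (inducedEndomorphism I I' f J x v) w = inner ℝ v (inducedEndomorphism I I' f J x w) := by
  rw [← hf.inner_mfderiv, ← hf.inner_mfderiv, hinv.mfderiv_inducedEndomorphism hf,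
    hinv.mfderiv_inducedEndomorphism hf, hJ.inner_comm]

/-- On an invariant submanifold of a locally metallic Riemannian manifold the induced structure is
covariant constant. -/
theorem IsLocallyMetallic.isCovariantConstant_inducedEndomorphism (hJ : IsLocallyMetallic p q J)
    (hf : IsIsometricImmersion I I' f) (hinv : IsInvariant I I' f J) :
    IsCovariantConstant (leviCivita I M) (inducedEndomorphism I I' f J) := by
  intro x Y hY
  have hT := hJ.mdifferentiableAt_inducedField hf hinv hY
  refine ⟨hT, fun v ↦ ext_inner_right ℝ fun w ↦ ?_⟩
  have h1 := hf.inner_covariantDerivAlong hT v w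
  rw [hJ.covariantDerivAlong_inducedField hf hinv hY, hJ.inner_comm,
    ← hinv.mfderiv_inducedEndomorphism hf, hf.inner_covariantDerivAlong hY,
    ← hJ.toIsMetallicRiemannian.inner_inducedEndomorphism_comm hf hinv] at h1
  exact h1.symm

lemma IsMetallicRiemannian.mem_normalSpace (hJ : IsMetallicRiemannian p q J)
    (hinv : IsInvariant I I' f J) {w : TangentSpace I' (f x)} (hw : w ∈ normalSpace I I' f x) :
    J (f x) w ∈ normalSpace I I' f x := by
  refine (Submodule.mem_orthogonal' _ _).2 fun u hu ↦ ?_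
  rw [hJ.inner_comm]
  exact (Submodule.mem_orthogonal' _ _).1 hw _ (hinv x u hu)

lemma IsMetallicRiemannian.starProjection_normalSpace (hJ : IsMetallicRiemannian p q J)
    (hinv : IsInvariant I I' f J) (w : TangentSpace I' (f x)) :
    (normalSpace I I' f x).starProjection (J (f x) w)
      = J (f x) ((normalSpace I I' f x).starProjection w) := by
  refine Submodule.eq_starProjection_of_mem_of_inner_eq_zero
    (hJ.mem_normalSpace hinv (Submodule.starProjection_apply_mem _ _)) fun u hu ↦ ?_
  rw [← map_sub, hJ.inner_comm]
  exact Submodule.starProjection_inner_eq_zero _ _ (hJ.mem_normalSpace hinv hu)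

/-- `h(X, JY) = J h(X, Y)`. -/
theorem IsLocallyMetallic.secondFundamentalForm_right (hJ : IsLocallyMetallic p q J)
    (hf : IsIsometricImmersion I I' f) (hinv : IsInvariant I I' f J)
    (X : Π y : M, TangentSpace I y) (hY : MDiffAt (T% Y) x) :
    (secondFundamentalForm I I' f X (inducedField I I' f J Y) x : TangentSpace I' (f x))
      = J (f x) (secondFundamentalForm I I' f X Y x) := by
  rw [secondFundamentalForm, hJ.covariantDerivAlong_inducedField hf hinv hY]
  exact hJ.toIsMetallicRiemannian.starProjection_normalSpace hinv _

/-- `h(JX, Y) = J h(X, Y)`. -/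
theorem IsLocallyMetallic.secondFundamentalForm_left (hJ : IsLocallyMetallic p q J)
    (hf : IsIsometricImmersion I I' f) (hinv : IsInvariant I I' f J)
    (hX : MDiffAt (T% X) x) (hY : MDiffAt (T% Y) x) :
    (secondFundamentalForm I I' f (inducedField I I' f J X) Y x : TangentSpace I' (f x))
      = J (f x) (secondFundamentalForm I I' f X Y x) := by
  rw [secondFundamentalForm_comm hf.contMDiff (hJ.mdifferentiableAt_inducedField hf hinv hX) hY,
    hJ.secondFundamentalForm_right hf hinv Y hX, secondFundamentalForm_comm hf.contMDiff hY hX]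

/-- `h(JX, JY) = p h(X, JY) + q h(X, Y)`. -/
theorem IsLocallyMetallic.secondFundamentalForm_inducedField (hJ : IsLocallyMetallic p q J)
    (hf : IsIsometricImmersion I I' f) (hinv : IsInvariant I I' f J)
    (hX : MDiffAt (T% X) x) (hY : MDiffAt (T% Y) x) :
    secondFundamentalForm I I' f (inducedField I I' f J X) (inducedField I I' f J Y) x
      = (p : ℝ) • secondFundamentalForm I I' f X (inducedField I I' f J Y) x
        + (q : ℝ) • secondFundamentalForm I I' f X Y x := by
  refine Subtype.ext ?_
  rw [hJ.secondFundamentalForm_right hf hinv _ hY, hJ.secondFundamentalForm_left hf hinv hX hY,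
    hJ.sq_apply, Submodule.coe_add, Submodule.coe_smul, Submodule.coe_smul,
    hJ.secondFundamentalForm_right hf hinv _ hY]

lemma sum_secondFundamentalTensor {ι : Type*} [Fintype ι]
    (ν : OrthonormalBasis ι ℝ (normalSpace I I' f x)) (X Y : Π y : M, TangentSpace I y) :
    ∑ α, secondFundamentalTensor I I' f (ν α) X Y • ν α = secondFundamentalForm I I' f X Y x := by
  conv_rhs => rw [← ν.sum_repr' (secondFundamentalForm I I' f X Y x)]
  exact Finset.sum_congr rfl fun α _ ↦ by rw [secondFundamentalTensor, real_inner_comm]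

lemma sum_secondFundamentalTensor_coe {ι : Type*} [Fintype ι]
    (ν : OrthonormalBasis ι ℝ (normalSpace I I' f x)) (X Y : Π y : M, TangentSpace I y) :
    ∑ α, secondFundamentalTensor I I' f (ν α) X Y • (ν α : TangentSpace I' (f x))
      = secondFundamentalForm I I' f X Y x := by
  rw [← sum_secondFundamentalTensor ν, Submodule.coe_sum]
  rfl

end Invariant

end Riem

theorem mainTheorem6 {n r : ℕ}
    {M : Type*} [TopologicalSpace M] [ChartedSpace (EuclideanSpace ℝ (Fin n)) M]
    [IsManifold (𝓡 n) ∞ M] [RiemannianBundle (fun x : M ↦ TangentSpace (𝓡 n) x)]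
    [IsContMDiffRiemannianBundle (𝓡 n) ∞ (EuclideanSpace ℝ (Fin n))
      (fun x : M ↦ TangentSpace (𝓡 n) x)]
    {N : Type*} [TopologicalSpace N] [ChartedSpace (EuclideanSpace ℝ (Fin (n + r))) N]
    [IsManifold (𝓡 (n + r)) ∞ N] [RiemannianBundle (fun y : N ↦ TangentSpace (𝓡 (n + r)) y)]
    [IsContMDiffRiemannianBundle (𝓡 (n + r)) ∞ (EuclideanSpace ℝ (Fin (n + r)))
      (fun y : N ↦ TangentSpace (𝓡 (n + r)) y)]
    (p q : ℕ) (J : Π y : N, TangentSpace (𝓡 (n + r)) y →L[ℝ] TangentSpace (𝓡 (n + r)) y)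
    (hJ : Riem.IsLocallyMetallic p q J) (f : M → N)
    (hf : Riem.IsIsometricImmersion (𝓡 n) (𝓡 (n + r)) f)
    (hinv : Riem.IsInvariant (𝓡 n) (𝓡 (n + r)) f J) :
    Riem.IsCovariantConstant (Riem.leviCivita (𝓡 n) M)
      (Riem.inducedEndomorphism (𝓡 n) (𝓡 (n + r)) f J) ∧
    ∀ (x : M) (ν : OrthonormalBasis (Fin r) ℝ (Riem.normalSpace (𝓡 n) (𝓡 (n + r)) f x))
      (X Y JX JY : Π y : M, TangentSpace (𝓡 n) y) (h : Fin r → (Π y : M, TangentSpace (𝓡 n) y) →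
        (Π y : M, TangentSpace (𝓡 n) y) → ℝ),
      MDifferentiableAt (𝓡 n) (𝓡 n).tangent (fun y ↦ (⟨y, X y⟩ : TangentBundle (𝓡 n) M)) x →
      MDifferentiableAt (𝓡 n) (𝓡 n).tangent (fun y ↦ (⟨y, Y y⟩ : TangentBundle (𝓡 n) M)) x →
      JX = Riem.inducedField (𝓡 n) (𝓡 (n + r)) f J X →
      JY = Riem.inducedField (𝓡 n) (𝓡 (n + r)) f J Y →
      h = (fun α V W ↦ Riem.secondFundamentalTensor (𝓡 n) (𝓡 (n + r)) f (ν α) V W) →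
      (∑ α, h α X JY • (ν α : TangentSpace (𝓡 (n + r)) (f x))
          = ∑ α, h α X Y • J (f x) (ν α) ∧
        ∑ α, h α X Y • J (f x) (ν α)
          = ∑ α, h α JX Y • (ν α : TangentSpace (𝓡 (n + r)) (f x))) ∧
      ∀ α, h α JX JY = p * h α X JY + q * h α X Y := by

  refine ⟨hJ.isCovariantConstant_inducedEndomorphism hf hinv, ?_⟩
  rintro x ν X Y JX JY h hX hY rfl rfl rfl
  have hsum : ∑ α, Riem.secondFundamentalTensor (𝓡 n) (𝓡 (n + r)) f (ν α) X Y • J (f x) (ν α)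
      = J (f x) (Riem.secondFundamentalForm (𝓡 n) (𝓡 (n + r)) f X Y x) := by
    rw [← Riem.sum_secondFundamentalTensor_coe ν, map_sum]
    exact Finset.sum_congr rfl fun α _ ↦ (map_smul _ _ _).symm
  refine ⟨⟨?_, ?_⟩, fun α ↦ ?_⟩
  · rw [hsum, Riem.sum_secondFundamentalTensor_coe, hJ.secondFundamentalForm_right hf hinv X hY]
  · rw [hsum, Riem.sum_secondFundamentalTensor_coe, hJ.secondFundamentalForm_left hf hinv hX hY]
  · simp only [Riem.secondFundamentalTensor]
    rw [hJ.secondFundamentalForm_inducedField hf hinv hX hY, inner_add_left]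
    exact congrArg₂ (· + ·)
      (real_inner_smul_left (F := Riem.normalSpace (𝓡 n) (𝓡 (n + r)) f x) _ _ _)
      (real_inner_smul_left (F := Riem.normalSpace (𝓡 n) (𝓡 (n + r)) f x) _ _ _)
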